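/- Let $k$ be a field with $\operatorname{char} k\neq 2,3$, let $\hat k/k$ be a quadratic extension with nontrivial automorphism $z\mapsto\bar z$, and put $\operatorname{Im}\hat k^*=\{q\in\hat k^*:\bar q=-q\}$ and $U(\hat k^*/\hat k^{*3})=\{\alpha\in \hat k^*/\hat k^{*3}:\alpha\bar\alpha=1\}$. Let $\mathrm{SL}(2,k)$ act on the binary cubic forms $P=ax^3+3bx^2y+3cxy^2+dy^3$ over $k$ by algebra automorphisms extending $\begin{pmatrix}\alpha&\beta\\ \gamma&\delta\end{pmatrix}\cdot x=\delta x-\beta y$, $\begin{pmatrix}\alpha&\beta\\ \gamma&\delta\end{pmatrix}\cdot y=-\gamma x+\alpha y$. Put $$Q_n(P)=a^2d^2-3b^2c^2-6abcd+4b^3d+4ac^3,\qquad \omega(P,P')=ad'-da'-3bc'+3cb',$$ with $\omega$ also used over $\hat k$. Let $\operatorname{Im}\hat k^*\times_{Z_2}U(\hat k^*/\hat k^{*3})$ be the quotient of $\operatorname{Im}\hat k^*\times U(\hat k^*/\hat k^{*3})$ by $(q,u)\sim(-q,u^{-1})$, let $[q,u]$ be the class of $(q,u)$, and let $\widehat{sq}([q,u])=q^2$.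 If $P$ is a binary cubic over $k$ with $Q_n(P)\in(\operatorname{Im}\hat k^*)^2$, then $P=\lambda\alpha^3+\bar\lambda\bar\alpha^3$ for some $\lambda\in\hat k^*$ and some linear form $\alpha$ over $\hat k$, and $$I(P)=[\,\omega(\lambda\alpha^3,\bar\lambda\bar\alpha^3),\ [\lambda\bar\lambda^{-1}]\,]\in \operatorname{Im}\hat k^*\times_{Z_2}U(\hat k^*/\hat k^{*3})$$ does not depend on the choice of $\lambda$ and $\alpha$. Let $M\in(\operatorname{Im}\hat k^*)^2$ (so $M\in k^*$ is not a square in $k$), and let $\mathcal O_M$ be the set of binary cubics $P$ over $k$ with $Q_n(P)=M$. The fibre $\widehat{sq}^{-1}(M)$ is a group under $[q,u][q,v]=[q,uv]$, where $q$ is either square root of $M$ in $\hat k$; the law does not depend on which root is used. (i) The map $I$ induces a bijection $\mathcal O_M/\mathrm{SL}(2,k)\to\widehat{sq}^{-1}(M)$, and hence, by pullback, a group structure on $\mathcal O_M/\mathrm{SL}(2,k)$. (ii) As groups, $\mathcal O_M/\mathrm{SL}(2,k)\cong U(\hat k^*/\hat k^{*3})$. (iii) For $P\in\mathcal O_M$,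 the orbit $\mathrm{SL}(2,k)\cdot P$ is the identity element of this group if and only if $P$ is reducible over $k$. -/

import Mathlib

noncomputable section

open scoped MatrixGroups

namespace BinCubic

/-! ### Binary cubics and the action of `SL(2,k)` -/

/-- Binary cubic forms over `k`: homogeneous polynomials of degree `3` in `x = X 0`, `y = X 1`. -/
def BinaryCubic (k : Type*) [Field k] : Type _ :=
  {P : MvPolynomial (Fin 2) k // P.IsHomogeneous 3}

/-- The linear form `e x + f y`. -/
def linForm {k : Type*} [Field k] (e f : k) : MvPolynomial (Fin 2) k :=
  MvPolynomial.C e * MvPolynomial.X 0 + MvPolynomial.C f * MvPolynomial.X 1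

theorem linForm_isHomogeneous {k : Type*} [Field k] (e f : k) :
    (linForm e f).IsHomogeneous 1 :=
  (by simpa using (MvPolynomial.isHomogeneous_C (Fin 2) e).mul (MvPolynomial.isHomogeneous_X k 0) :
    (MvPolynomial.C e * MvPolynomial.X (0 : Fin 2)).IsHomogeneous 1).add
  (by simpa using (MvPolynomial.isHomogeneous_C (Fin 2) f).mul (MvPolynomial.isHomogeneous_X k 1) :
    (MvPolynomial.C f * MvPolynomial.X (1 : Fin 2)).IsHomogeneous 1)

/-- The action of `g = (α β; γ δ)` on the coordinate functions (transpose inverse):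
`g · x = δ x - β y`, `g · y = -γ x + α y`. -/
def coordAct {k : Type*} [Field k] (g : SL(2, k)) : Fin 2 → MvPolynomial (Fin 2) k :=
  ![linForm (g.1 1 1) (-g.1 0 1), linForm (-g.1 1 0) (g.1 0 0)]

/-- The induced action of `g` on polynomials in `x`, `y`, by algebra endomorphisms. -/
def polyAct {k : Type*} [Field k] (g : SL(2, k)) :
    MvPolynomial (Fin 2) k →ₐ[k] MvPolynomial (Fin 2) k :=
  MvPolynomial.aeval (coordAct g)

theorem polyAct_isHomogeneous {k : Type*} [Field k] (g : SL(2, k))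
    {P : MvPolynomial (Fin 2) k} (hP : P.IsHomogeneous 3) : (polyAct g P).IsHomogeneous 3 := by
  have h : ∀ i, (coordAct g i).IsHomogeneous 1 := by
    intro i
    fin_cases i
    · exact linForm_isHomogeneous _ _
    · exact linForm_isHomogeneous _ _
  have := hP.aeval (coordAct g) h
  rwa [one_mul] at this

theorem polyAct_one {k : Type*} [Field k] :
    polyAct (1 : SL(2, k)) = AlgHom.id k (MvPolynomial (Fin 2) k) := by
  apply MvPolynomial.algHom_ext
  intro i
  fin_cases i <;> simp [polyAct, coordAct, linForm]

theorem polyAct_mul {k : Type*} [Field k] (g h : SL(2, k)) :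
    polyAct (g * h) = (polyAct g).comp (polyAct h) := by
  apply MvPolynomial.algHom_ext
  intro i
  fin_cases i <;>
    simp [polyAct, coordAct, linForm, Matrix.mul_apply, Fin.sum_univ_two] <;> ring

/-- The functorial action of `SL(2,k)` on binary cubics. -/
instance {k : Type*} [Field k] : MulAction SL(2, k) (BinaryCubic k) where
  smul g P := ⟨polyAct g P.1, polyAct_isHomogeneous g P.2⟩
  one_smul P := Subtype.ext (by
    change polyAct 1 P.1 = P.1
    rw [polyAct_one]; rfl)
  mul_smul g h P := Subtype.ext (by
    change polyAct (g * h) P.1 = polyAct g (polyAct h P.1)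
    rw [polyAct_mul]; rfl)

/-! ### Coefficients, symplectic form, moment map, quartic invariant

A cubic is written `a x³ + 3 b x² y + 3 c x y² + d y³`. -/

/-- The coefficient `a`. -/
def BinaryCubic.a {k : Type*} [Field k] (P : BinaryCubic k) : k :=
  P.1.coeff (Finsupp.single 0 3)

/-- The coefficient `b`, one third of the coefficient of `x² y`. -/
def BinaryCubic.b {k : Type*} [Field k] (P : BinaryCubic k) : k :=
  P.1.coeff (Finsupp.single 0 2 + Finsupp.single 1 1) / 3

/-- The coefficient `c`, one third of the coefficient of `x y²`. -/
def BinaryCubic.c {k : Type*} [Field k] (P : BinaryCubic k) : k :=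
  P.1.coeff (Finsupp.single 0 1 + Finsupp.single 1 2) / 3

/-- The coefficient `d`. -/
def BinaryCubic.d {k : Type*} [Field k] (P : BinaryCubic k) : k :=
  P.1.coeff (Finsupp.single 1 3)

/-- The symplectic form `ω(P, P') = a d' - d a' - 3 b c' + 3 c b'`. -/
def omega {k : Type*} [Field k] (P P' : BinaryCubic k) : k :=
  P.a * P'.d - P.d * P'.a - 3 * P.b * P'.c + 3 * P.c * P'.b

/-- The moment map. -/
def mu {k : Type*} [Field k] (P : BinaryCubic k) : Matrix (Fin 2) (Fin 2) k :=
  !![P.a * P.d - P.b * P.c, 2 * (P.b * P.d - P.c ^ 2);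
     2 * (P.b ^ 2 - P.a * P.c), -(P.a * P.d - P.b * P.c)]

/-- The normalised quartic invariant `Q_n(P) = - det μ(P)`. -/
def Qn {k : Type*} [Field k] (P : BinaryCubic k) : k :=
  -(mu P).det

/-- Apply a field homomorphism to all coefficients (base extension, Galois conjugation). -/
def BinaryCubic.map {k K : Type*} [Field k] [Field K] (f : k →+* K) (P : BinaryCubic k) :
    BinaryCubic K :=
  ⟨MvPolynomial.map f P.1, P.2.map f⟩

/-- The binary cubic `l (e x + f y)³`. -/
def scaledCube {k : Type*} [Field k] (l e f : k) : BinaryCubic k :=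
  ⟨MvPolynomial.C l * linForm e f ^ 3, by
    simpa using (MvPolynomial.isHomogeneous_C (Fin 2) l).mul
      ((linForm_isHomogeneous e f).pow 3)⟩

/-- The cubics over `k` with `Q_n(P) = M`. -/
def Level {k : Type*} [Field k] (M : k) : Type _ :=
  {P : BinaryCubic k // Qn P = M}

/-- Two cubics of the level set are equivalent when they lie in the same `SL(2,k)`-orbit. -/
def levelSetoid {k : Type*} [Field k] (M : k) : Setoid (Level M) :=
  (MulAction.orbitRel SL(2, k) (BinaryCubic k)).comap Subtype.val

/-- The space of `SL(2,k)`-orbits of cubics with `Q_n(P) = M`. -/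
def LevelOrbits {k : Type*} [Field k] (M : k) : Type _ :=
  Quotient (levelSetoid M)

/-- The orbit of a cubic. -/
def orbitOf {k : Type*} [Field k] {M : k} (P : Level M) : LevelOrbits M :=
  Quotient.mk (levelSetoid M) P

/-! ### The parameter space attached to a quadratic extension

Below `K/k` is a quadratic extension and `σ` its nontrivial automorphism, `σ z = z̄`. -/

/-- The group `K* / K*³`. -/
def ModCubes (K : Type*) [Field K] : Type _ :=
  Kˣ ⧸ (powMonoidHom 3 : Kˣ →* Kˣ).range

instance (K : Type*) [Field K] : CommGroup (ModCubes K) :=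
  QuotientGroup.Quotient.commGroup (powMonoidHom 3 : Kˣ →* Kˣ).range

/-- The class in `K* / K*³` of an element of `K*`. -/
def cubeClass (K : Type*) [Field K] : Kˣ →* ModCubes K :=
  QuotientGroup.mk' (powMonoidHom 3 : Kˣ →* Kˣ).range

/-- Conjugation on `K*`. -/
def unitsConj {k K : Type*} [Field k] [Field K] [Algebra k K] (σ : K ≃ₐ[k] K) : Kˣ →* Kˣ :=
  Units.map (σ : K →* K)

/-- Conjugation on `K* / K*³`. -/
def conjModCubes {k K : Type*} [Field k] [Field K] [Algebra k K] (σ : K ≃ₐ[k] K) :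
    ModCubes K →* ModCubes K :=
  QuotientGroup.lift (powMonoidHom 3 : Kˣ →* Kˣ).range ((cubeClass K).comp (unitsConj σ)) (by
    rintro _ ⟨y, rfl⟩
    exact (QuotientGroup.eq_one_iff _).2 ⟨unitsConj σ y, by simp⟩)

/-- The unitary group `U(K*/K*³) = {α : α ᾱ = 1}`. -/
def UCubes {k K : Type*} [Field k] [Field K] [Algebra k K] (σ : K ≃ₐ[k] K) :
    Subgroup (ModCubes K) where
  carrier := {α | α * conjModCubes σ α = 1}
  one_mem' := by simp
  mul_mem' := by
    intro α β hα hβ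
    change α * β * conjModCubes σ (α * β) = 1
    rw [map_mul, mul_mul_mul_comm α β, hα, hβ, one_mul]
  inv_mem' := by
    intro α hα
    change α⁻¹ * conjModCubes σ α⁻¹ = 1
    rw [map_inv, ← mul_inv, hα, inv_one]

/-- `Im K*`: the nonzero purely imaginary elements of `K`. -/
def ImUnits {k K : Type*} [Field k] [Field K] [Algebra k K] (σ : K ≃ₐ[k] K) : Type _ :=
  {q : K // q ≠ 0 ∧ σ q = -q}

/-- Equivalence under the `Z₂`-action `-1 · (q, u) = (-q, u⁻¹)` on `Im K* × U(K*/K*³)`. -/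
def paramSetoid {k K : Type*} [Field k] [Field K] [Algebra k K] (σ : K ≃ₐ[k] K) :
    Setoid (ImUnits σ × UCubes σ) where
  r p p' := (p'.1.1 = p.1.1 ∧ p'.2 = p.2) ∨ (p'.1.1 = -p.1.1 ∧ p'.2 = p.2⁻¹)
  iseqv := by
    refine ⟨fun p => Or.inl ⟨rfl, rfl⟩, ?_, ?_⟩
    · rintro p p' (⟨h, h'⟩ | ⟨h, h'⟩)
      · exact Or.inl ⟨h.symm, h'.symm⟩
      · exact Or.inr ⟨by rw [h, neg_neg], by rw [h', inv_inv]⟩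
    · rintro p p' p'' (⟨h, h'⟩ | ⟨h, h'⟩) (⟨i, i'⟩ | ⟨i, i'⟩)
      · exact Or.inl ⟨i.trans h, i'.trans h'⟩
      · exact Or.inr ⟨by rw [i, h], by rw [i', h']⟩
      · exact Or.inr ⟨by rw [i, h], by rw [i', h']⟩
      · exact Or.inl ⟨by rw [i, h, neg_neg], by rw [i', h', inv_inv]⟩

/-- The parameter space `Im K* ×_{Z₂} U(K*/K*³)`. -/
def OrbitParam {k K : Type*} [Field k] [Field K] [Algebra k K] (σ : K ≃ₐ[k] K) : Type _ :=
  Quotient (paramSetoid σ)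

/-- The class `[q, u]`. -/
def paramMk {k K : Type*} [Field k] [Field K] [Algebra k K] {σ : K ≃ₐ[k] K}
    (q : ImUnits σ) (u : UCubes σ) : OrbitParam σ :=
  Quotient.mk (paramSetoid σ) (q, u)

/-- The map `[q, u] ↦ q²`. -/
def paramSq {k K : Type*} [Field k] [Field K] [Algebra k K] {σ : K ≃ₐ[k] K} :
    OrbitParam σ → K :=
  Quotient.lift (fun p => p.1.1 ^ 2) (by
    rintro p p' (⟨h, -⟩ | ⟨h, -⟩)
    · simp only [h]
    · simp only [h, neg_sq])

/-- The fibre of `[q, u] ↦ q²` over `M`. -/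
def SqFibre {k K : Type*} [Field k] [Field K] [Algebra k K] (σ : K ≃ₐ[k] K) (M : k) : Type _ :=
  {z : OrbitParam σ // paramSq z = algebraMap k K M}

/-- The class `[q, u]` as a point of the fibre over `M = q²`. -/
def fibreMk {k K : Type*} [Field k] [Field K] [Algebra k K] {σ : K ≃ₐ[k] K} {M : k}
    (q : ImUnits σ) (hq : q.1 ^ 2 = algebraMap k K M) (u : UCubes σ) : SqFibre σ M :=
  ⟨paramMk q u, hq⟩

/-! ### The orbit invariant -/

/-- `M ∈ (Im K*)²`. -/
def IsImSquare {k K : Type*} [Field k] [Field K] [Algebra k K] (σ : K ≃ₐ[k] K) (M : k) : Prop :=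
  ∃ q : ImUnits σ, q.1 ^ 2 = algebraMap k K M

/-- `z = [ω(T, T̄), [l l̄⁻¹]]` for some decomposition `P = T + T̄` over `K`, where
`T = l (e x + f y)³` with `l ∈ K*`. -/
def IsOrbitInvariant {k K : Type*} [Field k] [Field K] [Algebra k K] (σ : K ≃ₐ[k] K)
    (P : BinaryCubic k) (z : OrbitParam σ) : Prop :=
  ∃ (l : Kˣ) (e f : K) (q : ImUnits σ) (u : UCubes σ),
    (P.map (algebraMap k K)).1 =
        (scaledCube (l : K) e f).1 + ((scaledCube (l : K) e f).map (σ : K →+* K)).1 ∧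
      q.1 = omega (scaledCube (l : K) e f) ((scaledCube (l : K) e f).map (σ : K →+* K)) ∧
      u.1 = cubeClass K (l * (unitsConj σ l)⁻¹) ∧
      z = paramMk q u

/-- The cubics `P` over `k` with `Q_n(P) ∈ (Im K*)²`. -/
def ImLocus {k K : Type*} [Field k] [Field K] [Algebra k K] (σ : K ≃ₐ[k] K) : Type _ :=
  {P : BinaryCubic k // IsImSquare σ (Qn P)}

theorem orbitParam_nonempty {k K : Type*} [Field k] [Field K] [Algebra k K] {σ : K ≃ₐ[k] K}
    (P : ImLocus σ) : Nonempty (OrbitParam σ) :=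
  P.2.elim fun q _ => ⟨paramMk q 1⟩

/-- The orbit invariant `I(P) = [ω(T, T̄), [l l̄⁻¹]]`, for any decomposition `P = T + T̄` as in
`IsOrbitInvariant`. -/
def orbitInvariant {k K : Type*} [Field k] [Field K] [Algebra k K] {σ : K ≃ₐ[k] K}
    (P : ImLocus σ) : OrbitParam σ :=
  @Classical.epsilon _ (orbitParam_nonempty P) (IsOrbitInvariant σ P.1)

/-- A cubic with `Q_n(P) = M ∈ (Im K*)²`, as a point of the domain of the invariant. -/
def Level.toImLocus {k K : Type*} [Field k] [Field K] [Algebra k K] {σ : K ≃ₐ[k] K} {M : k}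
    (hM : IsImSquare σ M) (P : Level M) : ImLocus σ :=
  ⟨P.1, P.2.symm ▸ hM⟩

end BinCubic

end

/-! Over `K` a cubic `P` with `Qn P = q ^ 2`, `q` imaginary and nonzero, is a sum `T + T̄` with `T =
l (e x + f y)³`. To find `T`, let `G` be the cubic covariant of `P`, with leading coefficient `a²d -
3abc + 2b³`. The Hessian of `P + q⁻¹ G` is a multiple of `1 - q⁻² Qn P = 0`, so `T = (P + q⁻¹ G) /
2` lies on the cone over the twisted cubic, and `T̄ = (P - q⁻¹ G) / 2` (`exists_isConjDecomp`).
Conversely `Qn P = ω(T, T̄)²` and `G = ω(T, T̄) (T - T̄)`, so `P` and the sign of `ω(T, T̄)`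
determine `T`. Changing the sign swaps `T` with `T̄` and inverts `[l l̄⁻¹]`, which is exactly the
`Z₂`-relation; hence the invariant is well defined (`IsOrbitInvariant.unique`).

Injectivity on orbits (`IsConjDecomp.exists_smul_eq`): equal classes `[l l̄⁻¹]` mean that `l` and
`l'` agree up to a cube and a factor in `k`. Equality of `ω` forces that factor to be a cube as
well, so the linear forms can be rescaled to have the same `l` and the same determinant with their
conjugates. The change of basis between the two conjugate pairs is then defined over `k` with
determinant 1. Surjectivity (`exists_isConjDecomp_of_param`) is an explicit choice of `l`, `e`, `f`,
using that `K*/K*³` has exponent 3.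

The identity is `[q, 1]`. The class of `l l̄⁻¹` is trivial exactly when `P` has a zero over `k`
(`IsConjDecomp.exists_zero_iff`), which for a nonzero cubic means reducible
(`not_irreducible_iff_exists_zero`). -/

open scoped MatrixGroups

namespace BinCubic

/-! ### Binary cubics in coordinates, and the action on coefficients. -/

section Polynomials

open MvPolynomial

/-- The polynomial `a x³ + 3 b x² y + 3 c x y² + d y³`. -/
noncomputable def cubicPoly {k : Type*} [Field k] (a b c d : k) : MvPolynomial (Fin 2) k :=
  C a * X 0 ^ 3 + C (3 * b) * (X 0 ^ 2 * X 1) + C (3 * c) * (X 0 * X 1 ^ 2) + C d * X 1 ^ 3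

theorem cubicPoly_eq_monomials {k : Type*} [Field k] (a b c d : k) :
    cubicPoly a b c d = monomial (Finsupp.single 0 3) a +
      monomial (Finsupp.single 0 2 + Finsupp.single 1 1) (3 * b) +
      monomial (Finsupp.single 0 1 + Finsupp.single 1 2) (3 * c) +
      monomial (Finsupp.single 1 3) d := by
  simp only [cubicPoly, X, monomial_pow, monomial_mul, C_mul_monomial, Finsupp.smul_single]
  simp

theorem cubicPoly_isHomogeneous {k : Type*} [Field k] (a b c d : k) :
    (cubicPoly a b c d).IsHomogeneous 3 := by
  rw [cubicPoly_eq_monomials]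
  refine ((IsHomogeneous.add ?_ ?_).add ?_).add ?_ <;>
    apply isHomogeneous_monomial <;> simp [map_add, Finsupp.degree_single]

/-- The binary cubic with coefficients `a`, `b`, `c`, `d`. -/
noncomputable def mkCubic {k : Type*} [Field k] (a b c d : k) : BinaryCubic k :=
  ⟨cubicPoly a b c d, cubicPoly_isHomogeneous a b c d⟩

section Coefficients

variable {k : Type*} [Field k] (a b c d : k)

theorem mkCubic_a : (mkCubic a b c d).a = a := by
  simp [BinaryCubic.a, mkCubic, cubicPoly_eq_monomials, coeff_monomial, Finsupp.ext_iff,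
    Fin.forall_fin_two]

theorem mkCubic_b (h3 : (3 : k) ≠ 0) : (mkCubic a b c d).b = b := by
  simp [BinaryCubic.b, mkCubic, cubicPoly_eq_monomials, coeff_monomial, Finsupp.ext_iff,
    Fin.forall_fin_two, h3]

theorem mkCubic_c (h3 : (3 : k) ≠ 0) : (mkCubic a b c d).c = c := by
  simp [BinaryCubic.c, mkCubic, cubicPoly_eq_monomials, coeff_monomial, Finsupp.ext_iff,
    Fin.forall_fin_two, h3]

theorem mkCubic_d : (mkCubic a b c d).d = d := by
  simp [BinaryCubic.d, mkCubic, cubicPoly_eq_monomials, coeff_monomial, Finsupp.ext_iff,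
    Fin.forall_fin_two]

end Coefficients

/-- Reduces polynomial identities to the four coefficients. Since `b` and `c` are defined by
division by 3, characteristic 3 must be excluded. -/
theorem BinaryCubic.eq_cubicPoly {k : Type*} [Field k] (h3 : (3 : k) ≠ 0) (P : BinaryCubic k) :
    P.1 = cubicPoly P.a P.b P.c P.d := by
  ext m
  by_cases hm : m.degree = 3
  · have hsum : m 0 + m 1 = 3 := by
      rw [← hm, Finsupp.degree_eq_sum, Fin.sum_univ_two]
    have hcases : m = Finsupp.single 0 3 ∨ m = Finsupp.single 0 2 + Finsupp.single 1 1 ∨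
        m = Finsupp.single 0 1 + Finsupp.single 1 2 ∨ m = Finsupp.single 1 3 := by
      simp only [Finsupp.ext_iff, Fin.forall_fin_two]
      simp
      omega
    rcases hcases with rfl | rfl | rfl | rfl
    · exact (mkCubic_a P.a P.b P.c P.d).symm
    · exact (div_left_inj' h3).1 (mkCubic_b P.a P.b P.c P.d h3).symm
    · exact (div_left_inj' h3).1 (mkCubic_c P.a P.b P.c P.d h3).symm
    · exact (mkCubic_d P.a P.b P.c P.d).symm
  · rw [P.2.coeff_eq_zero hm, (cubicPoly_isHomogeneous _ _ _ _).coeff_eq_zero hm]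

theorem BinaryCubic.eq_mkCubic {k : Type*} [Field k] (h3 : (3 : k) ≠ 0) (P : BinaryCubic k) :
    P = mkCubic P.a P.b P.c P.d :=
  Subtype.ext (P.eq_cubicPoly h3)

theorem BinaryCubic.ext_coeff {k : Type*} [Field k] (h3 : (3 : k) ≠ 0) {P P' : BinaryCubic k}
    (ha : P.a = P'.a) (hb : P.b = P'.b) (hc : P.c = P'.c) (hd : P.d = P'.d) : P = P' := by
  rw [P.eq_mkCubic h3, P'.eq_mkCubic h3, ha, hb, hc, hd]

theorem scaledCube_eq_mkCubic {k : Type*} [Field k] (l e f : k) :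
    scaledCube l e f = mkCubic (l * e ^ 3) (l * e ^ 2 * f) (l * e * f ^ 2) (l * f ^ 3) := by
  apply Subtype.ext
  simp only [scaledCube, mkCubic, cubicPoly, linForm, map_mul, map_pow, map_ofNat]
  ring

theorem mkCubic_map {k K : Type*} [Field k] [Field K] (φ : k →+* K) (a b c d : k) :
    (mkCubic a b c d).map φ = mkCubic (φ a) (φ b) (φ c) (φ d) := by
  apply Subtype.ext
  simp [BinaryCubic.map, mkCubic, cubicPoly, map_ofNat φ 3]

theorem cubicPoly_add {k : Type*} [Field k] (a b c d a' b' c' d' : k) :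
    cubicPoly a b c d + cubicPoly a' b' c' d' =
      cubicPoly (a + a') (b + b') (c + c') (d + d') := by
  simp only [cubicPoly, map_mul, map_add, map_ofNat]
  ring

theorem smul_mkCubic {k : Type*} [Field k] (g : SL(2, k)) (a b c d : k) :
    g • mkCubic a b c d =
      mkCubic
        (a * g.1 1 1 ^ 3 - 3 * b * g.1 1 1 ^ 2 * g.1 1 0 + 3 * c * g.1 1 1 * g.1 1 0 ^ 2
          - d * g.1 1 0 ^ 3)
        (-a * g.1 1 1 ^ 2 * g.1 0 1 + b * (g.1 1 1 ^ 2 * g.1 0 0 + 2 * g.1 1 1 * g.1 0 1 * g.1 1 0)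
          - c * (2 * g.1 1 1 * g.1 1 0 * g.1 0 0 + g.1 0 1 * g.1 1 0 ^ 2)
          + d * g.1 1 0 ^ 2 * g.1 0 0)
        (a * g.1 1 1 * g.1 0 1 ^ 2 - b * (2 * g.1 1 1 * g.1 0 1 * g.1 0 0 + g.1 0 1 ^ 2 * g.1 1 0)
          + c * (g.1 1 1 * g.1 0 0 ^ 2 + 2 * g.1 0 1 * g.1 1 0 * g.1 0 0)
          - d * g.1 1 0 * g.1 0 0 ^ 2)
        (-a * g.1 0 1 ^ 3 + 3 * b * g.1 0 1 ^ 2 * g.1 0 0 - 3 * c * g.1 0 1 * g.1 0 0 ^ 2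
          + d * g.1 0 0 ^ 3) := by
  apply Subtype.ext
  change polyAct g (cubicPoly a b c d) = cubicPoly _ _ _ _
  simp only [cubicPoly, polyAct, map_add, map_mul, map_pow, aeval_X, aeval_C, coordAct, linForm,
    Matrix.cons_val_zero, Matrix.cons_val_one, algebraMap_eq, map_neg, map_sub, map_ofNat]
  ring

theorem Qn_eq {k : Type*} [Field k] (P : BinaryCubic k) :
    Qn P = P.a ^ 2 * P.d ^ 2 - 3 * P.b ^ 2 * P.c ^ 2 - 6 * P.a * P.b * P.c * P.d
      + 4 * P.b ^ 3 * P.d + 4 * P.a * P.c ^ 3 := by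
  simp only [Qn, mu, Matrix.det_fin_two_of]
  ring

/-! ### Reducibility and zeros over the base field. -/

theorem eq_C_add_linForm_of_totalDegree_le_one {k : Type*} [Field k]
    (A : MvPolynomial (Fin 2) k) (hA : A.totalDegree ≤ 1) :
    ∃ r e f : k, A = C r + linForm e f := by
  refine ⟨A.coeff 0, A.coeff (Finsupp.single 0 1), A.coeff (Finsupp.single 1 1), ?_⟩
  ext m
  have hdeg : m.degree = m 0 + m 1 := by rw [Finsupp.degree_eq_sum, Fin.sum_univ_two]
  have hcases : m = 0 ∨ m = Finsupp.single 0 1 ∨ m = Finsupp.single 1 1 ∨ 1 < m.degree := by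
    simp only [Finsupp.ext_iff, Fin.forall_fin_two, hdeg]
    simp
    omega
  have hX : ∀ (i : Fin 2) (c : k), C c * X i = monomial (Finsupp.single i 1) c := by
    intro i c
    simp [X, C_mul_monomial]
  simp only [linForm, hX]
  rcases hcases with rfl | rfl | rfl | hm
  · simp [coeff_monomial]
  · simp [coeff_monomial, coeff_C, Finsupp.ext_iff, Fin.forall_fin_two]
  · simp [coeff_monomial, coeff_C, Finsupp.ext_iff, Fin.forall_fin_two]
  · rw [coeff_eq_zero_of_totalDegree_lt (lt_of_le_of_lt hA hm)]
    have h0 : (0 : Fin 2 →₀ ℕ) ≠ m := by rintro rfl; simp at hm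
    have h1 : (Finsupp.single 0 1 : Fin 2 →₀ ℕ) ≠ m := by rintro rfl; simp at hm
    have h2 : (Finsupp.single 1 1 : Fin 2 →₀ ℕ) ≠ m := by rintro rfl; simp at hm
    simp [coeff_monomial, coeff_C, h0, h1, h2]

/-- The value `P(s, t)`. -/
noncomputable def BinaryCubic.value {k : Type*} [Field k] (P : BinaryCubic k) (s t : k) : k :=
  P.a * s ^ 3 + 3 * P.b * s ^ 2 * t + 3 * P.c * s * t ^ 2 + P.d * t ^ 3

/-- Homogeneity of the factors is not needed. On the line spanned by the zero `(f, -e)` of the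
linear part of `A`, the factor `A` becomes constant, so `A * B` has degree at most 2 there, while
`P` restricts to `P(f, -e) X³`. -/
theorem exists_zero_of_linear_factor {k : Type*} [Field k] (h3 : (3 : k) ≠ 0)
    (P : BinaryCubic k) {A B : MvPolynomial (Fin 2) k} (hAB : P.1 = A * B)
    (hA : A.totalDegree = 1) (hB : B.totalDegree ≤ 2) :
    ∃ s t : k, (s ≠ 0 ∨ t ≠ 0) ∧ P.value s t = 0 := by
  obtain ⟨r, e, f, rfl⟩ := eq_C_add_linForm_of_totalDegree_le_one A hA.le
  refine ⟨f, -e, ?_, ?_⟩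
  · by_contra! h
    obtain ⟨hf, he⟩ := h
    rw [neg_eq_zero] at he
    subst hf he
    simp [linForm] at hA
  · let φ : Fin 2 → Polynomial k := ![Polynomial.C f * Polynomial.X, Polynomial.C (-e) * Polynomial.X]
    have hφ : ∀ i, (φ i).natDegree ≤ 1 := by
      intro i
      fin_cases i
      · exact (Polynomial.natDegree_C_mul_le _ _).trans Polynomial.natDegree_X_le
      · exact (Polynomial.natDegree_C_mul_le _ _).trans Polynomial.natDegree_X_le
    have hA' : aeval φ (C r + linForm e f) = Polynomial.C r := by
      simp only [linForm, map_add, map_mul, aeval_X, φ, Matrix.cons_val_zero, Matrix.cons_val_one,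
        algHom_C, Polynomial.algebraMap_eq, map_neg]
      ring
    have hP : aeval φ P.1 = Polynomial.C (P.value f (-e)) * Polynomial.X ^ 3 := by
      rw [P.eq_cubicPoly h3]
      simp only [cubicPoly, map_add, map_mul, aeval_X, φ, Matrix.cons_val_zero, map_pow,
        Matrix.cons_val_one, algHom_C, Polynomial.algebraMap_eq, map_neg, BinaryCubic.value]
      ring
    have hdeg := aeval_natDegree_le B hB φ hφ
    have h := congrArg (fun p => Polynomial.coeff (aeval φ p) 3) hAB
    simp only [map_mul, hP, hA', Polynomial.coeff_C_mul, Polynomial.coeff_X_pow] at h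
    rw [Polynomial.coeff_eq_zero_of_natDegree_lt (by omega)] at h
    simpa using h

theorem exists_linForm_factor_of_zero {k : Type*} [Field k] (h3 : (3 : k) ≠ 0)
    (P : BinaryCubic k) {s t : k} (hst : s ≠ 0 ∨ t ≠ 0) (h : P.value s t = 0) :
    ∃ Q, P.1 = linForm t (-s) * Q := by
  suffices h : ∃ A B D : k, P.a = t * A ∧ 3 * P.b = t * B - s * A ∧ 3 * P.c = t * D - s * B ∧
      P.d = -s * D by
    obtain ⟨A, B, D, ha, hb, hc, hd⟩ := h
    refine ⟨C A * X 0 ^ 2 + C B * (X 0 * X 1) + C D * X 1 ^ 2, ?_⟩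
    rw [P.eq_cubicPoly h3, cubicPoly, ha, hb, hc, hd]
    simp only [linForm, map_mul, map_sub, map_neg]
    ring
  rw [BinaryCubic.value] at h
  -- The quotient comes from long division by `t x - s y`, started at the `y³` end if `s ≠ 0` and at
  -- the `x³` end if `t ≠ 0`.
  rcases hst with hs | ht
  · refine ⟨(t * ((t * (-P.d / s) - 3 * P.c) / s) - 3 * P.b) / s, (t * (-P.d / s) - 3 * P.c) / s,
      -P.d / s, ?_, ?_, ?_, ?_⟩
    · field_simp
      linear_combination h
    all_goals field_simp <;> ring
  · refine ⟨P.a / t, (3 * P.b + s * (P.a / t)) / t,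
      (3 * P.c + s * ((3 * P.b + s * (P.a / t)) / t)) / t, ?_, ?_, ?_, ?_⟩
    case refine_4 =>
      field_simp
      linear_combination h
    all_goals field_simp <;> ring

theorem linForm_totalDegree {k : Type*} [Field k] {e f : k} (h : e ≠ 0 ∨ f ≠ 0) :
    (linForm e f).totalDegree = 1 := by
  refine (linForm_isHomogeneous e f).totalDegree fun h0 => ?_
  have h0' := congrArg (fun p => (eval ![1, 0] p, eval ![0, 1] p)) h0
  simp [linForm] at h0'
  tauto

theorem not_irreducible_iff_exists_zero {k : Type*} [Field k] (h3 : (3 : k) ≠ 0)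
    (P : BinaryCubic k) (hP : P.1 ≠ 0) :
    ¬ Irreducible P.1 ↔ ∃ s t : k, (s ≠ 0 ∨ t ≠ 0) ∧ P.value s t = 0 := by
  have hdeg : P.1.totalDegree = 3 := P.2.totalDegree hP
  have hunit : ∀ A : MvPolynomial (Fin 2) k, A ≠ 0 → (IsUnit A ↔ A.totalDegree = 0) := by
    intro A hA
    rw [isUnit_iff_totalDegree_of_isReduced]
    refine ⟨fun h => h.2, fun h => ⟨?_, h⟩⟩
    rw [isUnit_iff_ne_zero]
    intro h0
    rw [totalDegree_eq_zero_iff_eq_C.1 h, h0, map_zero] at hA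
    exact hA rfl
  constructor
  · intro hirr
    by_contra hno
    refine hirr ⟨fun hu => by rw [(hunit _ hP).1 hu] at hdeg; omega, fun A B hAB => ?_⟩
    have hA : A ≠ 0 := by rintro rfl; simp [hAB] at hP
    have hB : B ≠ 0 := by rintro rfl; simp [hAB] at hP
    rw [hAB, totalDegree_mul_of_isDomain hA hB] at hdeg
    rw [hunit A hA, hunit B hB]
    by_contra! hcon
    -- Two positive degrees with sum 3.
    have : A.totalDegree = 1 ∨ B.totalDegree = 1 := by omega
    rcases this with h1 | h1
    · exact hno (exists_zero_of_linear_factor h3 P hAB h1 (by omega))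
    · exact hno (exists_zero_of_linear_factor h3 P (hAB.trans (mul_comm A B)) h1 (by omega))
  · rintro ⟨s, t, hst, h⟩ hirr
    obtain ⟨Q, hQ⟩ := exists_linForm_factor_of_zero h3 P hst h
    have hL : (linForm t (-s)).totalDegree = 1 := linForm_totalDegree (by simpa using hst.symm)
    have hL0 : linForm t (-s) ≠ 0 := by intro h0; simp [h0] at hL
    have hQ0 : Q ≠ 0 := by rintro rfl; simp [hQ] at hP
    rw [hQ, totalDegree_mul_of_isDomain hL0 hQ0, hL] at hdeg
    rcases hirr.isUnit_or_isUnit hQ with hu | hu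
    · rw [hunit _ hL0] at hu; omega
    · rw [hunit _ hQ0] at hu; omega

end Polynomials

/-! ### The quadratic extension and conjugate decompositions. -/

section Quadratic

variable {k K : Type*} [Field k] [Field K] [Algebra k K] {σ : K ≃ₐ[k] K}

/-- In degree 2 the only intermediate algebras are `k` and `K`, and the fixed algebra of `σ` is not
`K`. -/
theorem exists_of_conj_eq_self (hK : Module.finrank k K = 2) (hσ : σ ≠ 1) {x : K}
    (hx : σ x = x) : ∃ y, algebraMap k K y = x := by
  have := Subalgebra.isSimpleOrder_of_finrank hK
  rcases eq_bot_or_eq_top (AlgHom.equalizer (σ : K →ₐ[k] K) (AlgHom.id k K)) with h | h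
  · have hmem : x ∈ AlgHom.equalizer (σ : K →ₐ[k] K) (AlgHom.id k K) := hx
    rw [h] at hmem
    exact Algebra.mem_bot.1 hmem
  · refine (hσ (AlgEquiv.ext fun z => ?_)).elim
    have hmem : z ∈ AlgHom.equalizer (σ : K →ₐ[k] K) (AlgHom.id k K) := h ▸ Algebra.mem_top
    exact hmem

/-- The fixed algebra of `σ²` contains the imaginary element `q`, which is not in `k` because `q ≠
-q`; so it is all of `K`. -/
theorem conj_conj (h2 : (2 : k) ≠ 0) (hK : Module.finrank k K = 2) (q : ImUnits σ) (x : K) :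
    σ (σ x) = x := by
  have h2K : (2 : K) ≠ 0 := by
    rw [← map_ofNat (algebraMap k K) 2]
    exact (map_ne_zero _).2 h2
  have := Subalgebra.isSimpleOrder_of_finrank hK
  let E := AlgHom.equalizer ((σ * σ : K ≃ₐ[k] K) : K →ₐ[k] K) (AlgHom.id k K)
  have hq : q.1 ∈ E := by
    change σ (σ q.1) = q.1
    rw [q.2.2, map_neg, q.2.2, neg_neg]
  rcases eq_bot_or_eq_top E with h | h
  · rw [h] at hq
    obtain ⟨y, hy⟩ := Algebra.mem_bot.1 hq
    have hfix : σ q.1 = q.1 := by rw [← hy]; exact σ.commutes y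
    rw [q.2.2] at hfix
    exact (q.2.1 ((mul_eq_zero.1 (by linear_combination -hfix : 2 * q.1 = 0)).resolve_left h2K)).elim
  · have hmem : x ∈ E := h ▸ Algebra.mem_top
    exact hmem

/-- `l (e x + f y)³` and its conjugate sum to `P`, in coordinates. -/
def IsConjDecomp (σ : K ≃ₐ[k] K) (P : BinaryCubic k) (l e f : K) : Prop :=
  algebraMap k K P.a = l * e ^ 3 + σ l * σ e ^ 3 ∧
  algebraMap k K P.b = l * e ^ 2 * f + σ l * σ e ^ 2 * σ f ∧
  algebraMap k K P.c = l * e * f ^ 2 + σ l * σ e * σ f ^ 2 ∧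
  algebraMap k K P.d = l * f ^ 3 + σ l * σ f ^ 3

theorem isConjDecomp_iff (h3 : (3 : k) ≠ 0) (P : BinaryCubic k) (l e f : K) :
    (P.map (algebraMap k K)).1 =
        (scaledCube l e f).1 + ((scaledCube l e f).map (σ : K →+* K)).1 ↔
      IsConjDecomp σ P l e f := by
  have h3K : (3 : K) ≠ 0 := by
    rw [← map_ofNat (algebraMap k K) 3]
    exact (map_ne_zero _).2 h3
  have h : (scaledCube l e f).1 + ((scaledCube l e f).map (σ : K →+* K)).1 =
      (mkCubic (l * e ^ 3 + σ l * σ e ^ 3) (l * e ^ 2 * f + σ l * σ e ^ 2 * σ f)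
        (l * e * f ^ 2 + σ l * σ e * σ f ^ 2) (l * f ^ 3 + σ l * σ f ^ 3)).1 := by
    rw [scaledCube_eq_mkCubic, mkCubic_map]
    simp only [mkCubic, cubicPoly_add]
    simp
  rw [h]
  conv_lhs => rw [P.eq_mkCubic h3, mkCubic_map]
  constructor
  · intro h'
    have h' := Subtype.ext h'
    refine ⟨?_, ?_, ?_, ?_⟩
    · simpa only [mkCubic_a] using congrArg BinaryCubic.a h'
    · simpa only [mkCubic_b _ _ _ _ h3K] using congrArg BinaryCubic.b h'
    · simpa only [mkCubic_c _ _ _ _ h3K] using congrArg BinaryCubic.c h'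
    · simpa only [mkCubic_d] using congrArg BinaryCubic.d h'
  · rintro ⟨ha, hb, hc, hd⟩
    rw [ha, hb, hc, hd]

/-- On cubes of linear forms, `ω` is the cube of the determinant of the two forms. -/
theorem omega_scaledCube_conj (h3 : (3 : k) ≠ 0) (l e f : K) :
    omega (scaledCube l e f) ((scaledCube l e f).map (σ : K →+* K)) =
      l * σ l * (e * σ f - f * σ e) ^ 3 := by
  have h3K : (3 : K) ≠ 0 := by
    rw [← map_ofNat (algebraMap k K) 3]
    exact (map_ne_zero _).2 h3
  rw [scaledCube_eq_mkCubic, mkCubic_map]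
  simp only [omega, mkCubic_a, mkCubic_b _ _ _ _ h3K, mkCubic_c _ _ _ _ h3K, mkCubic_d,
    RingHom.coe_coe, map_mul, map_pow]
  ring

theorem isOrbitInvariant_iff (h3 : (3 : k) ≠ 0) (P : BinaryCubic k) (z : OrbitParam σ) :
    IsOrbitInvariant σ P z ↔ ∃ (l : Kˣ) (e f : K) (q : ImUnits σ) (u : UCubes σ),
      IsConjDecomp σ P l e f ∧ q.1 = l * σ l * (e * σ f - f * σ e) ^ 3 ∧
      u.1 = cubeClass K (l * (unitsConj σ l)⁻¹) ∧ z = paramMk q u := by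
  simp only [IsOrbitInvariant, isConjDecomp_iff h3, omega_scaledCube_conj h3]

/-- This is `Qn P = ω(T, T̄)²`, which puts the invariant in the fibre over `Qn P` and fixes `ω(T,
T̄)` up to sign. -/
theorem IsConjDecomp.Qn {P : BinaryCubic k} {l e f : K} (h : IsConjDecomp σ P l e f) :
    algebraMap k K (Qn P) = (l * σ l * (e * σ f - f * σ e) ^ 3) ^ 2 := by
  obtain ⟨ha, hb, hc, hd⟩ := h
  rw [Qn_eq]
  simp only [map_add, map_sub, map_mul, map_pow, map_ofNat, ha, hb, hc, hd]
  ring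

/-- Matrices over `k` commute with conjugation, so `g` moves only the linear form and leaves `l`
alone. -/
theorem IsConjDecomp.smul (h3 : (3 : k) ≠ 0) {P : BinaryCubic k} {l e f : K}
    (h : IsConjDecomp σ P l e f) (g : SL(2, k)) :
    IsConjDecomp σ (g • P) l
      (e * algebraMap k K (g.1 1 1) - f * algebraMap k K (g.1 1 0))
      (-e * algebraMap k K (g.1 0 1) + f * algebraMap k K (g.1 0 0)) := by
  obtain ⟨ha, hb, hc, hd⟩ := h
  rw [P.eq_mkCubic h3, smul_mkCubic]
  simp only [IsConjDecomp, mkCubic_a, mkCubic_b _ _ _ _ h3, mkCubic_c _ _ _ _ h3, mkCubic_d,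
    map_add, map_sub, map_mul, map_pow, map_ofNat, map_neg, ha, hb, hc, hd, AlgEquiv.commutes]
  refine ⟨?_, ?_, ?_, ?_⟩ <;> ring

theorem IsConjDecomp.eq (h3 : (3 : k) ≠ 0) {P P' : BinaryCubic k} {l e f : K}
    (h : IsConjDecomp σ P l e f) (h' : IsConjDecomp σ P' l e f) : P = P' := by
  have hinj := (algebraMap k K).injective
  exact BinaryCubic.ext_coeff h3 (hinj (h.1.trans h'.1.symm)) (hinj (h.2.1.trans h'.2.1.symm))
    (hinj (h.2.2.1.trans h'.2.2.1.symm)) (hinj (h.2.2.2.trans h'.2.2.2.symm))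

theorem IsConjDecomp.conj (hσσ : ∀ x, σ (σ x) = x) {P : BinaryCubic k} {l e f : K}
    (h : IsConjDecomp σ P l e f) : IsConjDecomp σ P (σ l) (σ e) (σ f) := by
  obtain ⟨ha, hb, hc, hd⟩ := h
  simp only [IsConjDecomp, hσσ, ha, hb, hc, hd]
  refine ⟨?_, ?_, ?_, ?_⟩ <;> ring

theorem IsConjDecomp.scale {P : BinaryCubic k} {l e f m l' : K}
    (h : IsConjDecomp σ P l e f) (hl : l = l' * m ^ 3) :
    IsConjDecomp σ P l' (m * e) (m * f) := by
  obtain ⟨ha, hb, hc, hd⟩ := h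
  simp only [IsConjDecomp, ha, hb, hc, hd, hl, map_mul, map_pow]
  refine ⟨?_, ?_, ?_, ?_⟩ <;> ring

/-! ### Classes modulo cubes and the unitary class of a scalar. -/

theorem cubeClass_eq_one_iff (x : Kˣ) : cubeClass K x = 1 ↔ ∃ m : Kˣ, m ^ 3 = x :=
  QuotientGroup.eq_one_iff x

theorem cubeClass_eq_iff (x y : Kˣ) : cubeClass K x = cubeClass K y ↔ ∃ m : Kˣ, x = y * m ^ 3 := by
  rw [← div_eq_one, ← map_div, cubeClass_eq_one_iff]
  refine exists_congr fun m => ⟨fun h => ?_, fun h => ?_⟩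
  · rw [h, mul_div_cancel]
  · rw [h, mul_div_cancel_left]

theorem cube_eq_one (x : ModCubes K) : x ^ 3 = 1 := by
  obtain ⟨y, rfl⟩ := QuotientGroup.mk'_surjective (powMonoidHom 3 : Kˣ →* Kˣ).range x
  exact (cubeClass_eq_one_iff (y ^ 3)).2 ⟨y, rfl⟩

theorem unitsConj_unitsConj (hσσ : ∀ x, σ (σ x) = x) (l : Kˣ) :
    unitsConj σ (unitsConj σ l) = l :=
  Units.ext (hσσ l)

theorem conjModCubes_cubeClass (x : Kˣ) :
    conjModCubes σ (cubeClass K x) = cubeClass K (unitsConj σ x) := rfl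

/-- The class `[l l̄⁻¹]`, as an element of the unitary group. -/
noncomputable def unitaryClass (hσσ : ∀ x, σ (σ x) = x) (l : Kˣ) : UCubes σ :=
  ⟨cubeClass K (l * (unitsConj σ l)⁻¹), by
    change cubeClass K _ * conjModCubes σ (cubeClass K _) = 1
    rw [conjModCubes_cubeClass, ← map_mul, map_mul (unitsConj σ), map_inv,
      unitsConj_unitsConj hσσ]
    convert map_one (cubeClass K) using 2
    rw [mul_assoc, inv_mul_cancel_left, mul_inv_cancel]⟩

theorem unitaryClass_conj (hσσ : ∀ x, σ (σ x) = x) (l : Kˣ) :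
    unitaryClass hσσ (unitsConj σ l) = (unitaryClass hσσ l)⁻¹ := by
  apply Subtype.ext
  change cubeClass K _ = (cubeClass K _)⁻¹
  rw [unitsConj_unitsConj hσσ, ← map_inv (cubeClass K), mul_inv, inv_inv, mul_comm]

theorem unitaryClass_eq_of_eq_mul_cube (hσσ : ∀ x, σ (σ x) = x) {l l' m : Kˣ}
    (h : l = l' * m ^ 3) : unitaryClass hσσ l = unitaryClass hσσ l' := by
  apply Subtype.ext
  change cubeClass K _ = cubeClass K _
  rw [cubeClass_eq_iff]
  refine ⟨m * (unitsConj σ m)⁻¹, ?_⟩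
  rw [h, map_mul, map_pow, mul_inv, mul_pow, inv_pow]
  exact mul_mul_mul_comm _ _ _ _

/-- Put `t = l / l'`. The hypothesis says that `t` and `t̄` agree modulo cubes, so modulo cubes `t`
equals `t⁴`, hence `(t t̄)²`, which is fixed by `σ`. -/
theorem exists_eq_mul_cube_of_unitaryClass_eq (hσσ : ∀ x, σ (σ x) = x) {l l' : Kˣ}
    (h : unitaryClass hσσ l = unitaryClass hσσ l') :
    ∃ r n : Kˣ, σ r = r ∧ l = r * l' * n ^ 3 := by
  obtain ⟨m, hm⟩ := (cubeClass_eq_iff _ _).1 (congrArg Subtype.val h)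
  -- With `t̄ = t m⁻³` one has `(t t̄)² = t⁴ m⁻⁶`, so the complementary cube is `(m² / t)³`.
  refine ⟨((l / l') * unitsConj σ (l / l')) ^ 2, m ^ 2 / (l / l'), ?_, ?_⟩
  · have : unitsConj σ (((l / l') * unitsConj σ (l / l')) ^ 2) =
        ((l / l') * unitsConj σ (l / l')) ^ 2 := by
      rw [map_pow, map_mul, unitsConj_unitsConj hσσ, mul_comm]
    exact congrArg Units.val this
  · have hc : unitsConj σ (l / l') = (l / l') * (m ^ 3)⁻¹ := by
      rw [map_div]
      generalize unitsConj σ l = c at hm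
      generalize unitsConj σ l' = c' at hm
      rw [mul_inv_eq_iff_eq_mul] at hm
      rw [hm]
      apply Units.ext
      push_cast
      field_simp
    rw [hc]
    apply Units.ext
    push_cast
    field_simp

end Quadratic

/-! ### Existence and uniqueness of decompositions, and the orbits they determine. -/

section Decomposition

variable {k K : Type*} [Field k] [Field K] [Algebra k K] {σ : K ≃ₐ[k] K}

/-- The value `ω(T, T̄)` for `T = l (e x + f y)³`. -/
def conjPairing (σ : K ≃ₐ[k] K) (l e f : K) : K := l * σ l * (e * σ f - f * σ e) ^ 3

theorem conj_conjPairing (hσσ : ∀ x, σ (σ x) = x) (l e f : K) :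
    σ (conjPairing σ l e f) = -conjPairing σ l e f := by
  simp only [conjPairing, map_mul, map_pow, map_sub, hσσ]
  ring

theorem conjPairing_conj (hσσ : ∀ x, σ (σ x) = x) (l e f : K) :
    conjPairing σ (σ l) (σ e) (σ f) = -conjPairing σ l e f := by
  simp only [conjPairing, hσσ]
  ring

/-- A binary cubic whose coefficients satisfy the equations of the twisted cubic is a multiple of
the cube of a linear form. -/
theorem exists_scaledCube_coeffs {a b c d : K} (h : a ≠ 0 ∨ b ≠ 0 ∨ c ≠ 0 ∨ d ≠ 0)
    (hac : a * c = b ^ 2) (hbd : b * d = c ^ 2) (had : a * d = b * c) :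
    ∃ (l : Kˣ) (e f : K),
      a = l * e ^ 3 ∧ b = l * e ^ 2 * f ∧ c = l * e * f ^ 2 ∧ d = l * f ^ 3 := by
  by_cases ha : a = 0
  · subst ha
    have hb : b = 0 := pow_eq_zero_iff two_ne_zero |>.1 (by rw [← hac, zero_mul])
    subst hb
    have hc : c = 0 := pow_eq_zero_iff two_ne_zero |>.1 (by rw [← hbd, zero_mul])
    subst hc
    have hd : d ≠ 0 := by simpa using h
    exact ⟨Units.mk0 d hd, 0, 1, by simp⟩
  · refine ⟨Units.mk0 a ha, 1, b / a, by simp, ?_, ?_, ?_⟩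
    · simp only [Units.val_mk0]
      field_simp
    · simp only [Units.val_mk0]
      field_simp
      linear_combination hac
    · simp only [Units.val_mk0]
      field_simp
      linear_combination a * had + b * hac

/-- The summand is `T = (P + q⁻¹ G) / 2`, with `G` the cubic covariant of `P`; as `q⁻¹` is
imaginary, `T + T̄ = P`. -/
theorem exists_isConjDecomp (h2 : (2 : k) ≠ 0) (P : BinaryCubic k) (q : ImUnits σ)
    (hq : q.1 ^ 2 = algebraMap k K (Qn P)) :
    ∃ (l : Kˣ) (e f : K), IsConjDecomp σ P l e f := by
  obtain ⟨q, hq0, hσq⟩ := q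
  simp only at hq
  obtain ⟨h, hh⟩ : ∃ h : k, 2 * h = 1 := ⟨2⁻¹, mul_inv_cancel₀ h2⟩
  have hh' : 2 * algebraMap k K h = 1 := by
    rw [← map_one (algebraMap k K), ← hh, map_mul, map_ofNat]
  have hi : algebraMap k K (Qn P) * q⁻¹ ^ 2 = 1 := by
    rw [← hq, ← mul_pow, mul_inv_cancel₀ hq0, one_pow]
  have hσi : σ q⁻¹ = -q⁻¹ := by rw [map_inv₀, hσq, inv_neg]
  have hi0 := hi
  rw [Qn_eq] at hi
  simp only [map_add, map_sub, map_mul, map_pow, map_ofNat] at hi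
  generalize q⁻¹ = i at hi hσi hi0
  -- Here `h` is `1/2` and `i` is `q⁻¹`; the four left-hand sides are the coefficients of `T`.
  have key : ∃ (l : Kˣ) (e f : K),
      algebraMap k K h * (algebraMap k K P.a + i * algebraMap k K
        (P.a ^ 2 * P.d - 3 * P.a * P.b * P.c + 2 * P.b ^ 3)) = l * e ^ 3 ∧
      algebraMap k K h * (algebraMap k K P.b + i * algebraMap k K
        (P.a * P.b * P.d - 2 * P.a * P.c ^ 2 + P.b ^ 2 * P.c)) = l * e ^ 2 * f ∧
      algebraMap k K h * (algebraMap k K P.c - i * algebraMap k K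
        (P.a * P.c * P.d - 2 * P.b ^ 2 * P.d + P.b * P.c ^ 2)) = l * e * f ^ 2 ∧
      algebraMap k K h * (algebraMap k K P.d - i * algebraMap k K
        (P.a * P.d ^ 2 - 3 * P.b * P.c * P.d + 2 * P.c ^ 3)) = l * f ^ 3 := by
    apply exists_scaledCube_coeffs
    -- If `T = 0` then `P = T + T̄ = 0`, against `Qn P * i² = 1`.
    · by_contra! hcon
      have hzero : ∀ x y : k, algebraMap k K h * (algebraMap k K x + i * algebraMap k K y) = 0 →
          x = 0 := by
        intro x y hxy
        have hxy' := congrArg σ hxy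
        simp only [map_mul, map_add, AlgEquiv.commutes, hσi, map_zero] at hxy'
        apply (algebraMap k K).injective
        rw [map_zero]
        linear_combination hxy + hxy' - algebraMap k K x * hh'
      have hzero' : ∀ x y : k, algebraMap k K h * (algebraMap k K x - i * algebraMap k K y) = 0 →
          x = 0 := fun x y hxy => hzero x (-y) (by rw [map_neg, mul_neg, ← sub_eq_add_neg, hxy])
      obtain ⟨ha, hb, hc, hd⟩ := hcon
      have hQ : Qn P = 0 := by
        rw [Qn_eq, hzero _ _ ha, hzero _ _ hb, hzero' _ _ hc, hzero' _ _ hd]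
        ring
      rw [hQ, map_zero, zero_mul] at hi0
      exact zero_ne_one hi0
    -- Each twisted cubic equation for `T` is the corresponding Hessian coefficient of `P` times `h²
    -- (1 - i² Qn P)`, which is zero.
    · simp only [map_add, map_sub, map_mul, map_pow, map_ofNat]
      linear_combination (-algebraMap k K h ^ 2 *
        (algebraMap k K P.a * algebraMap k K P.c - algebraMap k K P.b ^ 2)) * hi
    · simp only [map_add, map_sub, map_mul, map_pow, map_ofNat]
      linear_combination (-algebraMap k K h ^ 2 *
        (algebraMap k K P.b * algebraMap k K P.d - algebraMap k K P.c ^ 2)) * hi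
    · simp only [map_add, map_sub, map_mul, map_pow, map_ofNat]
      linear_combination (-algebraMap k K h ^ 2 *
        (algebraMap k K P.a * algebraMap k K P.d - algebraMap k K P.b * algebraMap k K P.c)) * hi
  obtain ⟨l, e, f, ha, hb, hc, hd⟩ := key
  have hfin : ∀ x T y : K, σ x = x → σ y = y → algebraMap k K h * (x + i * y) = T →
      x = T + σ T := by
    rintro x _ y hx hy rfl
    simp only [map_mul, map_add, AlgEquiv.commutes, hσi, hx, hy]
    linear_combination -x * hh'
  have hfin' : ∀ x T y : K, σ x = x → σ y = y → algebraMap k K h * (x - i * y) = T →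
      x = T + σ T := fun x T y hx hy hxy =>
    hfin x T (-y) hx (by rw [map_neg, hy]) (by rw [mul_neg, ← sub_eq_add_neg, hxy])
  have ha' := hfin _ _ _ (σ.commutes _) (σ.commutes _) ha
  have hb' := hfin _ _ _ (σ.commutes _) (σ.commutes _) hb
  have hc' := hfin' _ _ _ (σ.commutes _) (σ.commutes _) hc
  have hd' := hfin' _ _ _ (σ.commutes _) (σ.commutes _) hd
  simp only [map_mul, map_pow] at ha' hb' hc' hd'
  exact ⟨l, e, f, ha', hb', hc', hd'⟩

/-- A decomposition is determined up to a cube by the value of `ω(T, T̄)`. -/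
theorem IsConjDecomp.exists_eq_mul_cube (h2 : (2 : k) ≠ 0) {P : BinaryCubic k} {l l' : Kˣ}
    {e f e' f' : K} (h : IsConjDecomp σ P l e f) (h' : IsConjDecomp σ P l' e' f')
    (hw : conjPairing σ l e f = conjPairing σ l' e' f') (hw0 : conjPairing σ l e f ≠ 0) :
    ∃ m : Kˣ, l = l' * m ^ 3 := by
  have h2K : (2 : K) ≠ 0 := by
    rw [← map_ofNat (algebraMap k K) 2]
    exact (map_ne_zero _).2 h2
  -- The extreme coefficients of `G = ω(T, T̄) (T - T̄)`. Together with `P = T + T̄` they recover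
  -- the `x³` and `y³` coefficients of `T`.
  have hG : ∀ {l e f : K}, IsConjDecomp σ P l e f →
      algebraMap k K (P.a ^ 2 * P.d - 3 * P.a * P.b * P.c + 2 * P.b ^ 3) =
        conjPairing σ l e f * (l * e ^ 3 - σ l * σ e ^ 3) ∧
      algebraMap k K (P.a * P.d ^ 2 - 3 * P.b * P.c * P.d + 2 * P.c ^ 3) =
        -conjPairing σ l e f * (l * f ^ 3 - σ l * σ f ^ 3) := by
    rintro l e f ⟨ha, hb, hc, hd⟩
    simp only [map_add, map_sub, map_mul, map_pow, map_ofNat, ha, hb, hc, hd, conjPairing]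
    constructor <;> ring
  have hE : (l : K) * e ^ 3 = l' * e' ^ 3 := by
    have h1 := (hG h).1.symm.trans (hG h').1
    rw [← hw] at h1
    have h1 := mul_left_cancel₀ hw0 h1
    apply mul_left_cancel₀ h2K
    linear_combination h1 + h.1.symm.trans h'.1
  have hF : (l : K) * f ^ 3 = l' * f' ^ 3 := by
    have h1 := (hG h).2.symm.trans (hG h').2
    rw [← hw] at h1
    have h1 := mul_left_cancel₀ (neg_ne_zero.2 hw0) h1
    apply mul_left_cancel₀ h2K
    linear_combination h1 + h.2.2.2.symm.trans h'.2.2.2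
  have hcube : ∀ {x x' : K}, x ≠ 0 → (l : K) * x ^ 3 = l' * x' ^ 3 →
      ∃ m : Kˣ, l = l' * m ^ 3 := by
    intro x x' hx hxx
    have hx' : x' ≠ 0 := by
      rintro rfl
      simp [hx] at hxx
    refine ⟨Units.mk0 x' hx' / Units.mk0 x hx, Units.ext ?_⟩
    push_cast
    simp only [Units.val_mk0]
    field_simp
    exact hxx
  by_cases he : e = 0
  · have hf : f ≠ 0 := by
      rintro rfl
      simp [conjPairing, he] at hw0
    exact hcube hf hF
  · exact hcube he hE

/-- Once `l = l'` and the determinants of the two conjugate pairs of linear forms agree, the matrix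
carrying one pair to the other commutes with `σ` and lies in `SL(2, k)`. -/
theorem IsConjDecomp.exists_smul_eq (h3 : (3 : k) ≠ 0)
    (hfix : ∀ x, σ x = x → ∃ y, algebraMap k K y = x)
    (hσσ : ∀ x, σ (σ x) = x) {P P' : BinaryCubic k} {l l' : Kˣ} {e f e' f' : K}
    (h : IsConjDecomp σ P l e f) (h' : IsConjDecomp σ P' l' e' f')
    (hw : conjPairing σ l e f = conjPairing σ l' e' f') (hw0 : conjPairing σ l e f ≠ 0)
    (hu : unitaryClass hσσ l = unitaryClass hσσ l') : ∃ g : SL(2, k), g • P = P' := by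
  obtain ⟨r, n, hr, hl⟩ := exists_eq_mul_cube_of_unitaryClass_eq hσσ hu
  have hσl : ∀ x : Kˣ, σ (x : K) ≠ 0 := fun x => (map_ne_zero σ).2 x.ne_zero
  have hD : e * σ f - f * σ e ≠ 0 := by
    intro h0
    simp [conjPairing, h0] at hw0
  have hD' : e' * σ f' - f' * σ e' ≠ 0 := by
    intro h0
    rw [hw] at hw0
    simp [conjPairing, h0] at hw0
  obtain ⟨m, hlm, hmD⟩ : ∃ m : K, (l : K) = l' * m ^ 3 ∧
      m * σ m * (e * σ f - f * σ e) = e' * σ f' - f' * σ e' := by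
    have hlK : (l : K) = r * l' * n ^ 3 := by rw [hl]; push_cast; rfl
    have hrD : (r : K) ^ 2 * (n * σ n * (e * σ f - f * σ e)) ^ 3 = (e' * σ f' - f' * σ e') ^ 3 := by
      apply mul_left_cancel₀ (mul_ne_zero l'.ne_zero (hσl l'))
      simp only [conjPairing, hlK, map_mul, map_pow, hr] at hw
      linear_combination hw
    set D := n * σ n * (e * σ f - f * σ e) with hDdef
    have hD0 : D ≠ 0 := mul_ne_zero (mul_ne_zero n.ne_zero (hσl n)) hD
    have hσD : σ D = -D := by
      simp only [hDdef, map_mul, map_sub, hσσ]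
      ring
    have hσD' : σ (e' * σ f' - f' * σ e') = -(e' * σ f' - f' * σ e') := by
      simp only [map_mul, map_sub, hσσ]
      ring
    generalize e' * σ f' - f' * σ e' = D' at *
    -- `D` and `D'` are both imaginary, so `ρ = r D / D'` is fixed by `σ`, and `r² D³ = D'³` gives
    -- `ρ³ = r`. Hence `m = ρ n` absorbs `r` into the cube.
    refine ⟨r * D / D' * n, ?_, ?_⟩
    · rw [hlK]
      have := r.ne_zero
      field_simp
      linear_combination -hrD
    · have hs : σ (r * D / D' * n) = r * D / D' * σ n := by
        simp only [map_mul, map_div₀, hr, hσD, hσD']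
        field_simp
      rw [hs]
      calc r * D / D' * n * (r * D / D' * σ n) * (e * σ f - f * σ e)
          = (r * D / D') ^ 2 * D := by rw [hDdef]; ring
        _ = (r ^ 2 * D ^ 3) / D' ^ 2 := by ring
        _ = D' := by rw [hrD]; field_simp
  have h1 := h.scale hlm
  generalize he2 : m * e = e2 at h1
  generalize hf2 : m * f = f2 at h1
  have hD2 : e2 * σ f2 - f2 * σ e2 = e' * σ f' - f' * σ e' := by
    rw [← hmD, ← he2, ← hf2, map_mul, map_mul]
    ring
  have hD20 : e2 * σ f2 - f2 * σ e2 ≠ 0 := hD2 ▸ hD'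
  -- Cramer's rule: each matrix entry is a quotient of two elements negated by `σ`, hence lies in
  -- `k`.
  have hratio : ∀ x y : K, ∃ c : k,
      algebraMap k K c = (x * σ y - σ x * y) / (e2 * σ f2 - f2 * σ e2) := by
    intro x y
    apply hfix
    simp only [map_div₀, map_sub, map_mul, hσσ]
    rw [← neg_div_neg_eq]
    congr 1 <;> ring
  obtain ⟨δ, hδ⟩ := hratio e' f2
  obtain ⟨γ, hγ⟩ := hratio e' e2
  obtain ⟨β, hβ⟩ := hratio f2 f'
  obtain ⟨α, hα⟩ := hratio e2 f'
  have hdet : α * δ - β * γ = 1 := by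
    apply (algebraMap k K).injective
    rw [map_sub, map_mul, map_mul, hα, hβ, hγ, hδ, map_one]
    rw [div_mul_div_comm, div_mul_div_comm, ← sub_div, div_eq_one_iff_eq (mul_ne_zero hD20 hD20)]
    linear_combination -(e2 * σ f2 - f2 * σ e2) * hD2
  let g : SL(2, k) := ⟨!![α, β; γ, δ], by rw [Matrix.det_fin_two_of, hdet]⟩
  refine ⟨g, ?_⟩
  have hg := h1.smul h3 g
  have he : e2 * algebraMap k K (g.1 1 1) - f2 * algebraMap k K (g.1 1 0) = e' := by
    change e2 * algebraMap k K δ - f2 * algebraMap k K γ = e'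
    rw [hδ, hγ]
    field_simp
    ring
  have hf : -e2 * algebraMap k K (g.1 0 1) + f2 * algebraMap k K (g.1 0 0) = f' := by
    change -e2 * algebraMap k K β + f2 * algebraMap k K α = f'
    rw [hβ, hα]
    field_simp
    ring
  rw [he, hf] at hg
  exact hg.eq h3 h'

theorem exists_cubic_isConjDecomp (h3 : (3 : k) ≠ 0)
    (hfix : ∀ x, σ x = x → ∃ y, algebraMap k K y = x) (hσσ : ∀ x, σ (σ x) = x) (l e f : K) :
    ∃ P : BinaryCubic k, IsConjDecomp σ P l e f := by
  have htr : ∀ x, ∃ y, algebraMap k K y = x + σ x := fun x =>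
    hfix _ (by rw [map_add, hσσ, add_comm])
  obtain ⟨a, ha⟩ := htr (l * e ^ 3)
  obtain ⟨b, hb⟩ := htr (l * e ^ 2 * f)
  obtain ⟨c, hc⟩ := htr (l * e * f ^ 2)
  obtain ⟨d, hd⟩ := htr (l * f ^ 3)
  refine ⟨mkCubic a b c d, ?_⟩
  simp only [IsConjDecomp, mkCubic_a, mkCubic_b _ _ _ _ h3, mkCubic_c _ _ _ _ h3, mkCubic_d,
    ha, hb, hc, hd, map_mul, map_pow, and_self]

/-- If `v` represents `u`, then `[v̄] = [v]⁻¹`, so `l = v̄ c` has class `[v̄ v⁻¹] = [v]⁻² = [v]`.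
The factor `c` stays free for adjusting `ω`. -/
theorem exists_unitaryClass_eq (hσσ : ∀ x, σ (σ x) = x) (u : UCubes σ) :
    ∃ v : Kˣ, ∀ c : Kˣ, σ c = c → unitaryClass hσσ (unitsConj σ v * c) = u := by
  obtain ⟨u, hu⟩ := u
  obtain ⟨v, rfl⟩ := QuotientGroup.mk'_surjective (powMonoidHom 3 : Kˣ →* Kˣ).range u
  refine ⟨v, fun c hc => Subtype.ext ?_⟩
  change cubeClass K _ = cubeClass K v
  have hc' : unitsConj σ c = c := Units.ext hc
  have hu' : cubeClass K v * cubeClass K (unitsConj σ v) = 1 := hu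
  have hv : cubeClass K (unitsConj σ v) = (cubeClass K v)⁻¹ := eq_inv_of_mul_eq_one_right hu'
  have h3 := cube_eq_one (cubeClass K v)
  rw [map_mul (unitsConj σ), unitsConj_unitsConj hσσ, hc', mul_inv, mul_mul_mul_comm,
    mul_inv_cancel, mul_one, map_mul, map_inv, hv, inv_mul_eq_iff_eq_mul, eq_comm,
    eq_inv_iff_mul_eq_one, ← pow_two, ← pow_succ]
  exact h3

theorem exists_isConjDecomp_of_param (h2 : (2 : k) ≠ 0) (h3 : (3 : k) ≠ 0)
    (hfix : ∀ x, σ x = x → ∃ y, algebraMap k K y = x) (hσσ : ∀ x, σ (σ x) = x)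
    (q : ImUnits σ) (u : UCubes σ) :
    ∃ (P : BinaryCubic k) (l : Kˣ) (e f : K), IsConjDecomp σ P l e f ∧
      conjPairing σ l e f = q.1 ∧ unitaryClass hσσ l = u := by
  obtain ⟨q, hq0, hσq⟩ := q
  have h2K : (2 : K) ≠ 0 := by
    rw [← map_ofNat (algebraMap k K) 2]
    exact (map_ne_zero _).2 h2
  obtain ⟨v, hv⟩ := exists_unitaryClass_eq hσσ u
  have hv0 : (v : K) ≠ 0 := v.ne_zero
  have hσv0 : σ (v : K) ≠ 0 := (map_ne_zero σ).2 v.ne_zero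
  -- With `N = v v̄` and `c = N q²`, `l l̄ = N³ q⁴`. Taking `e = 1` and `f = -1 / (2 N q)` makes the
  -- determinant `1 / (N q)`, so the pairing is exactly `q`.
  let c : Kˣ := v * unitsConj σ v * Units.mk0 q hq0 ^ 2
  have hcK : (c : K) = v * σ v * q ^ 2 := rfl
  have hc : σ (c : K) = c := by
    simp only [hcK, map_mul, map_pow, hσσ, hσq]
    ring
  have hl : ((unitsConj σ v * c : Kˣ) : K) = σ v * c := rfl
  obtain ⟨P, hP⟩ := exists_cubic_isConjDecomp h3 hfix hσσ ((unitsConj σ v * c : Kˣ) : K) 1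
    (-(v * σ v * q)⁻¹ / 2)
  refine ⟨P, _, _, _, hP, ?_, hv c hc⟩
  simp only [conjPairing, hl, map_mul, hσσ, hc, map_div₀, map_neg, map_inv₀, hσq, map_ofNat,
    map_one]
  rw [hcK]
  field_simp
  ring

theorem IsConjDecomp.value {P : BinaryCubic k} {l e f : K} (h : IsConjDecomp σ P l e f) (s t : k) :
    algebraMap k K (P.value s t) =
      l * (e * algebraMap k K s + f * algebraMap k K t) ^ 3 +
      σ l * (σ e * algebraMap k K s + σ f * algebraMap k K t) ^ 3 := by
  obtain ⟨ha, hb, hc, hd⟩ := h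
  simp only [BinaryCubic.value, map_add, map_mul, map_pow, map_ofNat, ha, hb, hc, hd]
  ring

/-- At a zero over `k` the linear form takes a nonzero value `z` with `l z³ = -l̄ z̄³`, so `l l̄⁻¹`
is the cube of `-z̄ / z`. Conversely, a trivial class gives `l = r n³` with `r` fixed by `σ`, and `P
= r (β³ + β̄³)` for `β = n (e x + f y)` is divisible by `β + β̄`, a form over `k`. -/
theorem IsConjDecomp.exists_zero_iff (hfix : ∀ x, σ x = x → ∃ y, algebraMap k K y = x)
    (hσσ : ∀ x, σ (σ x) = x) {P : BinaryCubic k} {l : Kˣ} {e f : K}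
    (h : IsConjDecomp σ P l e f) (hw0 : conjPairing σ l e f ≠ 0) :
    (∃ s t : k, (s ≠ 0 ∨ t ≠ 0) ∧ P.value s t = 0) ↔ unitaryClass hσσ l = 1 := by
  have hone : unitaryClass hσσ 1 = 1 := by
    apply Subtype.ext
    change cubeClass K _ = 1
    rw [map_one, inv_one, mul_one, map_one]
  have hD : e * σ f - f * σ e ≠ 0 := by
    intro h0
    simp [conjPairing, h0] at hw0
  have hσl : ∀ x : K, x ≠ 0 → σ x ≠ 0 := fun x => (map_ne_zero σ).2
  constructor
  · rintro ⟨s, t, hst, hP⟩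
    have hval := h.value s t
    rw [hP, map_zero] at hval
    have hσz : σ (e * algebraMap k K s + f * algebraMap k K t) =
        σ e * algebraMap k K s + σ f * algebraMap k K t := by
      simp only [map_add, map_mul, AlgEquiv.commutes]
    rw [← hσz] at hval
    have hz : e * algebraMap k K s + f * algebraMap k K t ≠ 0 := by
      intro hz
      rw [hz, map_zero] at hσz
      have hs : algebraMap k K s = 0 := by
        apply (mul_eq_zero.1 _).resolve_left hD
        linear_combination σ f * hz + f * hσz
      have ht : algebraMap k K t = 0 := by
        apply (mul_eq_zero.1 _).resolve_left hD
        linear_combination -σ e * hz - e * hσz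
      rw [map_eq_zero] at hs ht
      exact hst.elim (· hs) (· ht)
    generalize e * algebraMap k K s + f * algebraMap k K t = z at hval hz
    apply Subtype.ext
    change cubeClass K _ = 1
    rw [cubeClass_eq_one_iff]
    refine ⟨-(Units.mk0 (σ z) (hσl z hz) / Units.mk0 z hz), Units.ext ?_⟩
    have hcl : ((unitsConj σ l : Kˣ) : K) = σ l := rfl
    have hl0 := hσl _ l.ne_zero
    push_cast
    simp only [Units.val_mk0, hcl]
    field_simp
    linear_combination hval
  · intro hu
    obtain ⟨r, n, hr, hl⟩ := exists_eq_mul_cube_of_unitaryClass_eq hσσ (hu.trans hone.symm)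
    have hlK : (l : K) = r * n ^ 3 := by rw [hl]; push_cast; ring
    have htr : ∀ x, ∃ y, algebraMap k K y = x + σ x := fun x =>
      hfix _ (by rw [map_add, hσσ, add_comm])
    obtain ⟨s, hs⟩ := htr (n * f)
    obtain ⟨t, ht⟩ := htr (n * e)
    -- The zero of `β + β̄ = t x + s y`.
    refine ⟨s, -t, ?_, ?_⟩
    · by_contra! hcon
      obtain ⟨hs0, ht0⟩ := hcon
      rw [hs0, map_zero, map_mul] at hs
      rw [neg_eq_zero.1 ht0, map_zero, map_mul] at ht
      refine mul_ne_zero (mul_ne_zero n.ne_zero (hσl _ n.ne_zero)) hD ?_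
      linear_combination (n * f) * ht - (n * e) * hs
    · apply (algebraMap k K).injective
      rw [h.value, map_neg, hs, ht, map_zero, hlK]
      simp only [map_mul, map_pow, hr]
      ring

end Decomposition

/-! ### The invariant: well-definedness, constancy on orbits, injectivity and surjectivity. -/

section Invariant

variable {k K : Type*} [Field k] [Field K] [Algebra k K] {σ : K ≃ₐ[k] K}

theorem isOrbitInvariant_iff_unitaryClass (h3 : (3 : k) ≠ 0) (hσσ : ∀ x, σ (σ x) = x)
    (P : BinaryCubic k) (z : OrbitParam σ) :
    IsOrbitInvariant σ P z ↔ ∃ (l : Kˣ) (e f : K) (q : ImUnits σ),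
      IsConjDecomp σ P l e f ∧ q.1 = conjPairing σ l e f ∧ z = paramMk q (unitaryClass hσσ l) := by
  rw [isOrbitInvariant_iff h3]
  constructor
  · rintro ⟨l, e, f, q, u, hP, hq, hu, rfl⟩
    obtain rfl : u = unitaryClass hσσ l := Subtype.ext hu
    exact ⟨l, e, f, q, hP, hq, rfl⟩
  · rintro ⟨l, e, f, q, hP, hq, rfl⟩
    exact ⟨l, e, f, q, _, hP, hq, rfl, rfl⟩

theorem paramMk_eq_iff (q q' : ImUnits σ) (u u' : UCubes σ) :
    paramMk q u = paramMk q' u' ↔ (q'.1 = q.1 ∧ u' = u) ∨ (q'.1 = -q.1 ∧ u' = u⁻¹) :=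
  Quotient.eq

theorem exists_isOrbitInvariant (h2 : (2 : k) ≠ 0) (h3 : (3 : k) ≠ 0) (hσσ : ∀ x, σ (σ x) = x)
    (P : ImLocus σ) : ∃ z, IsOrbitInvariant σ P.1 z := by
  obtain ⟨P, q, hq⟩ := P
  obtain ⟨l, e, f, hP⟩ := exists_isConjDecomp h2 P q hq
  have h0 : conjPairing σ (l : K) e f ≠ 0 := by
    intro h0
    have hQ := hP.Qn
    rw [← conjPairing, h0, ← hq, zero_pow two_ne_zero] at hQ
    exact q.2.1 (pow_eq_zero_iff two_ne_zero |>.1 hQ)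
  exact ⟨_, (isOrbitInvariant_iff_unitaryClass h3 hσσ P _).2
    ⟨l, e, f, ⟨_, h0, conj_conjPairing hσσ l e f⟩, hP, rfl, rfl⟩⟩

theorem IsOrbitInvariant.unique (h2 : (2 : k) ≠ 0) (h3 : (3 : k) ≠ 0) (hσσ : ∀ x, σ (σ x) = x)
    {P : BinaryCubic k} {z z' : OrbitParam σ} (h : IsOrbitInvariant σ P z)
    (h' : IsOrbitInvariant σ P z') : z = z' := by
  rw [isOrbitInvariant_iff_unitaryClass h3 hσσ] at h h'
  obtain ⟨l, e, f, q, hP, hq, rfl⟩ := h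
  obtain ⟨l', e', f', q', hP', hq', rfl⟩ := h'
  rw [paramMk_eq_iff]
  have hw : conjPairing σ l e f ^ 2 = conjPairing σ l' e' f' ^ 2 := hP.Qn.symm.trans hP'.Qn
  have hw0 : conjPairing σ (l : K) e f ≠ 0 := hq ▸ q.2.1
  rw [hq, hq']
  -- Equal signs give the same `l` up to a cube. Opposite signs reduce to this after conjugating the
  -- second decomposition, which inverts its class.
  rcases sq_eq_sq_iff_eq_or_eq_neg.1 hw with hw | hw
  · obtain ⟨m, hm⟩ := hP.exists_eq_mul_cube h2 hP' hw hw0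
    exact Or.inl ⟨hw.symm, (unitaryClass_eq_of_eq_mul_cube hσσ hm).symm⟩
  · have hw' : conjPairing σ l e f = conjPairing σ (unitsConj σ l' : Kˣ) (σ e') (σ f') :=
      hw.trans (conjPairing_conj hσσ (l' : K) e' f').symm
    obtain ⟨m, hm⟩ := hP.exists_eq_mul_cube h2 (hP'.conj hσσ) hw' hw0
    refine Or.inr ⟨by rw [hw, neg_neg], ?_⟩
    rw [unitaryClass_eq_of_eq_mul_cube hσσ hm, unitaryClass_conj, inv_inv]

theorem isOrbitInvariant_iff_orbitInvariant_eq (h2 : (2 : k) ≠ 0) (h3 : (3 : k) ≠ 0)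
    (hσσ : ∀ x, σ (σ x) = x) (P : ImLocus σ) (z : OrbitParam σ) :
    IsOrbitInvariant σ P.1 z ↔ orbitInvariant P = z := by
  have hspec : IsOrbitInvariant σ P.1 (orbitInvariant P) :=
    Classical.epsilon_spec (exists_isOrbitInvariant h2 h3 hσσ P)
  exact ⟨fun h => hspec.unique h2 h3 hσσ h, fun h => h ▸ hspec⟩

theorem IsOrbitInvariant.smul (h3 : (3 : k) ≠ 0) (hσσ : ∀ x, σ (σ x) = x) {P : BinaryCubic k}
    {z : OrbitParam σ} (h : IsOrbitInvariant σ P z) (g : SL(2, k)) :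
    IsOrbitInvariant σ (g • P) z := by
  rw [isOrbitInvariant_iff_unitaryClass h3 hσσ] at h ⊢
  obtain ⟨l, e, f, q, hP, hq, rfl⟩ := h
  refine ⟨l, _, _, q, hP.smul h3 g, ?_, rfl⟩
  have hdet := congrArg (algebraMap k K) (g.1.det_fin_two.symm.trans g.2)
  simp only [map_sub, map_mul, map_one] at hdet
  rw [hq, conjPairing, conjPairing]
  simp only [map_add, map_sub, map_mul, map_neg, AlgEquiv.commutes]
  congr 2
  linear_combination -(e * σ f - f * σ e) * hdet

theorem IsOrbitInvariant.exists_smul_eq (h3 : (3 : k) ≠ 0)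
    (hfix : ∀ x, σ x = x → ∃ y, algebraMap k K y = x) (hσσ : ∀ x, σ (σ x) = x)
    {P P' : BinaryCubic k} {z : OrbitParam σ} (h : IsOrbitInvariant σ P z)
    (h' : IsOrbitInvariant σ P' z) : ∃ g : SL(2, k), g • P = P' := by
  rw [isOrbitInvariant_iff_unitaryClass h3 hσσ] at h h'
  obtain ⟨l, e, f, q, hP, hq, rfl⟩ := h
  obtain ⟨l', e', f', q', hP', hq', hz⟩ := h'
  have hw0 : conjPairing σ (l : K) e f ≠ 0 := hq ▸ q.2.1
  rw [paramMk_eq_iff, hq, hq'] at hz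
  rcases hz with ⟨hw, hu⟩ | ⟨hw, hu⟩
  · exact hP.exists_smul_eq h3 hfix hσσ hP' hw.symm hw0 hu.symm
  · refine hP.exists_smul_eq (l' := unitsConj σ l') h3 hfix hσσ (hP'.conj hσσ) ?_ hw0 ?_
    · exact (neg_eq_iff_eq_neg.2 hw).symm.trans (conjPairing_conj hσσ (l' : K) e' f').symm
    · rw [unitaryClass_conj, hu, inv_inv]

theorem IsOrbitInvariant.paramSq_eq (h3 : (3 : k) ≠ 0) {P : BinaryCubic k} {z : OrbitParam σ}
    (h : IsOrbitInvariant σ P z) : paramSq z = algebraMap k K (Qn P) := by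
  rw [isOrbitInvariant_iff h3] at h
  obtain ⟨l, e, f, q, u, hP, hq, -, rfl⟩ := h
  rw [hP.Qn, ← hq]
  rfl

theorem exists_isOrbitInvariant_paramMk (h2 : (2 : k) ≠ 0) (h3 : (3 : k) ≠ 0)
    (hfix : ∀ x, σ x = x → ∃ y, algebraMap k K y = x) (hσσ : ∀ x, σ (σ x) = x)
    (z : OrbitParam σ) : ∃ P, IsOrbitInvariant σ P z := by
  obtain ⟨⟨q, u⟩, rfl⟩ := Quotient.exists_rep z
  obtain ⟨P, l, e, f, hP, hq, rfl⟩ := exists_isConjDecomp_of_param h2 h3 hfix hσσ q u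
  exact ⟨P, (isOrbitInvariant_iff_unitaryClass h3 hσσ P _).2 ⟨l, e, f, q, hP, hq.symm, rfl⟩⟩

theorem IsOrbitInvariant.eq_paramMk_one_iff (h3 : (3 : k) ≠ 0)
    (hfix : ∀ x, σ x = x → ∃ y, algebraMap k K y = x) (hσσ : ∀ x, σ (σ x) = x)
    {P : BinaryCubic k} {z : OrbitParam σ} (h : IsOrbitInvariant σ P z) (q : ImUnits σ)
    (hq : q.1 ^ 2 = algebraMap k K (Qn P)) :
    z = paramMk q 1 ↔ ¬ Irreducible P.1 := by
  -- The zero polynomial is also not irreducible; it is excluded because `Qn P = q² ≠ 0`.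
  have hP0 : P.1 ≠ 0 := by
    intro h0
    have hQ : Qn P = 0 := by
      rw [Qn_eq]
      simp [BinaryCubic.a, BinaryCubic.b, BinaryCubic.c, BinaryCubic.d, h0]
    rw [hQ, map_zero] at hq
    exact q.2.1 (pow_eq_zero_iff two_ne_zero |>.1 hq)
  rw [isOrbitInvariant_iff_unitaryClass h3 hσσ] at h
  obtain ⟨l, e, f, q', hP, hq', rfl⟩ := h
  rw [not_irreducible_iff_exists_zero h3 P hP0,
    hP.exists_zero_iff hfix hσσ (hq' ▸ q'.2.1), paramMk_eq_iff]
  have hsq : q.1 ^ 2 = q'.1 ^ 2 := by rw [hq, hq', hP.Qn, conjPairing]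
  constructor
  · rintro (⟨-, h⟩ | ⟨-, h⟩)
    · exact h.symm
    · exact inv_eq_one.1 h.symm
  · intro hu
    rw [hu, inv_one]
    simpa using sq_eq_sq_iff_eq_or_eq_neg.1 hsq

/-! ### The group structure on the fibre and the map from orbits. -/

/-- The `Z₂`-action exchanges the two distinct roots `q` and `-q`, so each class in the fibre has
exactly one representative with first entry `q`. -/
theorem fibreMk_bijective (h2 : (2 : k) ≠ 0) {M : k} (q : ImUnits σ)
    (hq : q.1 ^ 2 = algebraMap k K M) : Function.Bijective (fibreMk (M := M) q hq) := by
  have h2K : (2 : K) ≠ 0 := by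
    rw [← map_ofNat (algebraMap k K) 2]
    exact (map_ne_zero _).2 h2
  constructor
  · intro u v huv
    rcases (paramMk_eq_iff q q u v).1 (congrArg Subtype.val huv) with ⟨-, h⟩ | ⟨h, -⟩
    · exact h.symm
    · exact (q.2.1 ((mul_eq_zero.1 (by linear_combination h : 2 * q.1 = 0)).resolve_left h2K)).elim
  · rintro ⟨z, hz⟩
    obtain ⟨⟨q', u⟩, rfl⟩ := Quotient.exists_rep z
    have hsq : q.1 ^ 2 = q'.1 ^ 2 := hq.trans hz.symm
    rcases sq_eq_sq_iff_eq_or_eq_neg.1 hsq with h | h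
    · exact ⟨u, Subtype.ext ((paramMk_eq_iff q q' u u).2 (Or.inl ⟨h.symm, rfl⟩))⟩
    · exact ⟨u⁻¹, Subtype.ext ((paramMk_eq_iff q q' u⁻¹ u).2
        (Or.inr ⟨by rw [h, neg_neg], by rw [inv_inv]⟩))⟩

theorem fibreMk_eq_fibreMk_inv {M : k} {q q' : ImUnits σ} (hq : q.1 ^ 2 = algebraMap k K M)
    (hq' : q'.1 ^ 2 = algebraMap k K M) (h : q.1 = -q'.1) (u : UCubes σ) :
    fibreMk (M := M) q hq u = fibreMk q' hq' u⁻¹ :=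
  Subtype.ext ((paramMk_eq_iff _ _ _ _).2 (Or.inr ⟨by rw [h, neg_neg], rfl⟩))

/-- The group structure on the fibre over `M`, for which `u ↦ [q, u]` is an isomorphism. -/
@[reducible] noncomputable def fibreGroup (h2 : (2 : k) ≠ 0) {M : k} (q : ImUnits σ)
    (hq : q.1 ^ 2 = algebraMap k K M) : Group (SqFibre σ M) :=
  (Equiv.ofBijective _ (fibreMk_bijective h2 q hq)).symm.group

/-- The isomorphism `u ↦ [q, u]`. -/
noncomputable def fibreMulEquiv (h2 : (2 : k) ≠ 0) {M : k} (q : ImUnits σ)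
    (hq : q.1 ^ 2 = algebraMap k K M) :
    letI := fibreGroup h2 q hq
    UCubes σ ≃* SqFibre σ M :=
  letI := fibreGroup h2 q hq
  ((Equiv.ofBijective _ (fibreMk_bijective h2 q hq)).symm.mulEquiv).symm

/-- The group law on the fibre does not depend on the chosen square root of `M`. -/
theorem fibreMk_mul_fibreMk (h2 : (2 : k) ≠ 0) {M : k} (q₀ : ImUnits σ)
    (hq₀ : q₀.1 ^ 2 = algebraMap k K M) (q : ImUnits σ) (hq : q.1 ^ 2 = algebraMap k K M)
    (u v : UCubes σ) :
    letI := fibreGroup h2 q₀ hq₀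
    fibreMk q hq u * fibreMk q hq v = fibreMk q hq (u * v) := by
  let := fibreGroup h2 q₀ hq₀
  have hmul : ∀ u v : UCubes σ,
      fibreMk q₀ hq₀ u * fibreMk q₀ hq₀ v = fibreMk q₀ hq₀ (u * v) :=
    fun u v => (map_mul (fibreMulEquiv h2 q₀ hq₀) u v).symm
  rcases sq_eq_sq_iff_eq_or_eq_neg.1 (hq.trans hq₀.symm) with h | h
  · obtain rfl : q = q₀ := Subtype.ext h
    exact hmul u v
  -- Changing the root inverts `u`, and inversion is multiplicative because the unitary group is
  -- commutative.
  · rw [fibreMk_eq_fibreMk_inv hq hq₀ h, fibreMk_eq_fibreMk_inv hq hq₀ h,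
      fibreMk_eq_fibreMk_inv hq hq₀ h, mul_inv]
    exact hmul _ _

/-- The map on orbits induced by the invariant. -/
noncomputable def orbitMap (h2 : (2 : k) ≠ 0) (h3 : (3 : k) ≠ 0) (hσσ : ∀ x, σ (σ x) = x) {M : k}
    (hM : IsImSquare σ M) : LevelOrbits M → SqFibre σ M :=
  Quotient.lift
    (fun P => ⟨orbitInvariant (P.toImLocus hM), by
      rw [((isOrbitInvariant_iff_orbitInvariant_eq h2 h3 hσσ (P.toImLocus hM) _).2 rfl).paramSq_eq
        h3]
      exact congrArg _ P.2⟩)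
    (by
      rintro P P' ⟨g, hg⟩
      refine Subtype.ext ((isOrbitInvariant_iff_orbitInvariant_eq h2 h3 hσσ _ _).1 ?_)
      have h := ((isOrbitInvariant_iff_orbitInvariant_eq h2 h3 hσσ (P'.toImLocus hM) _).2 rfl).smul
        h3 hσσ g
      have hg' : g • (P'.toImLocus hM).1 = (P.toImLocus hM).1 := hg
      rwa [hg'] at h)

theorem orbitMap_bijective (h2 : (2 : k) ≠ 0) (h3 : (3 : k) ≠ 0)
    (hfix : ∀ x, σ x = x → ∃ y, algebraMap k K y = x) (hσσ : ∀ x, σ (σ x) = x) {M : k}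
    (hM : IsImSquare σ M) : Function.Bijective (orbitMap h2 h3 hσσ hM) := by
  constructor
  · intro x y hxy
    obtain ⟨P, rfl⟩ := Quotient.exists_rep x
    obtain ⟨P', rfl⟩ := Quotient.exists_rep y
    have hP := (isOrbitInvariant_iff_orbitInvariant_eq h2 h3 hσσ (P.toImLocus hM) _).2 rfl
    have hP' := (isOrbitInvariant_iff_orbitInvariant_eq h2 h3 hσσ (P'.toImLocus hM) _).2
      (congrArg Subtype.val hxy).symm
    obtain ⟨g, hg⟩ := hP'.exists_smul_eq h3 hfix hσσ hP
    exact Quotient.sound ⟨g, hg⟩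
  · rintro ⟨z, hz⟩
    obtain ⟨P, hP⟩ := exists_isOrbitInvariant_paramMk h2 h3 hfix hσσ z
    have hQ : Qn P = M := (algebraMap k K).injective ((hP.paramSq_eq h3).symm.trans hz)
    let L : Level M := ⟨P, hQ⟩
    exact ⟨orbitOf L, Subtype.ext
      ((isOrbitInvariant_iff_orbitInvariant_eq h2 h3 hσσ (L.toImLocus hM) z).1 hP)⟩

end Invariant

end BinCubic

/-! ### The main theorem. -/

theorem mainTheorem4 {k K : Type*} [Field k] [Field K] [Algebra k K]
    (h2 : (2 : k) ≠ 0) (h3 : (3 : k) ≠ 0) (hK : Module.finrank k K = 2)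
    (σ : K ≃ₐ[k] K) (hσ : σ ≠ 1)
    (M : k) (hM : BinCubic.IsImSquare σ M) :
    -- the invariant is well defined
    (∀ (P : BinCubic.ImLocus σ) (z : BinCubic.OrbitParam σ),
      BinCubic.IsOrbitInvariant σ P.1 z ↔ BinCubic.orbitInvariant P = z) ∧
    -- the fibre over `M` is a group under `[q, u] [q, v] = [q, u v]`, for every root `q` of `M`
    ∃ (_ : Group (BinCubic.SqFibre σ M)),
      (∀ (q : BinCubic.ImUnits σ) (hq : q.1 ^ 2 = algebraMap k K M) (u v : BinCubic.UCubes σ),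
        BinCubic.fibreMk q hq u * BinCubic.fibreMk q hq v = BinCubic.fibreMk q hq (u * v)) ∧
      -- (i) the invariant induces a bijection, and the group law is pulled back along it
      ∃ (_ : Group (BinCubic.LevelOrbits M)) (I : BinCubic.LevelOrbits M ≃* BinCubic.SqFibre σ M),
        (∀ P : BinCubic.Level M,
          (I (BinCubic.orbitOf P)).1 = BinCubic.orbitInvariant (P.toImLocus hM)) ∧
        -- (ii)
        Nonempty (BinCubic.LevelOrbits M ≃* BinCubic.UCubes σ) ∧
        -- (iii)
        (∀ P : BinCubic.Level M, BinCubic.orbitOf P = 1 ↔ ¬ Irreducible P.1.1) := by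
  have hfix : ∀ x, σ x = x → ∃ y, algebraMap k K y = x :=
    fun x hx => BinCubic.exists_of_conj_eq_self hK hσ hx
  obtain ⟨q, hq⟩ := id hM
  have hσσ : ∀ x, σ (σ x) = x := BinCubic.conj_conj h2 hK q
  refine ⟨BinCubic.isOrbitInvariant_iff_orbitInvariant_eq h2 h3 hσσ,
    BinCubic.fibreGroup h2 q hq, BinCubic.fibreMk_mul_fibreMk h2 q hq, ?_⟩
  let := BinCubic.fibreGroup h2 q hq
  let E := Equiv.ofBijective _ (BinCubic.orbitMap_bijective h2 h3 hfix hσσ hM)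
  let : Group (BinCubic.LevelOrbits M) := E.group
  let I : BinCubic.LevelOrbits M ≃* BinCubic.SqFibre σ M := E.mulEquiv
  refine ⟨inferInstance, I, fun P => rfl, ⟨I.trans (BinCubic.fibreMulEquiv h2 q hq).symm⟩,
    fun P => ?_⟩
  have hP := (BinCubic.isOrbitInvariant_iff_orbitInvariant_eq h2 h3 hσσ (P.toImLocus hM) _).2 rfl
  -- The identity of the fibre is `[q, 1]`, so the claim becomes the reducibility criterion for the
  -- invariant.
  have hone : BinCubic.fibreMk q hq 1 = 1 := map_one (BinCubic.fibreMulEquiv h2 q hq)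
  rw [← map_eq_one_iff I I.injective, ← hone]
  have hqP : q.1 ^ 2 = algebraMap k K (BinCubic.Qn P.1) := by rw [P.2, hq]
  exact Subtype.ext_iff.trans (hP.eq_paramMk_one_iff h3 hfix hσσ q hqP)
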